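/- **Loop property of the harmonic flow on $T^2$.** Let $T^2=\mathbb R^2/\mathbb Z^2$ carry the symplectic form $\omega=dx\wedge dy$ and the flat metric $dx^2+dy^2$. For a smooth symplectic isotopy $\Phi=\{\phi_t\}_{t\in[0,1]}$ of $(T^2,\omega)$ with $\phi_0=\mathrm{Id}$ and generating vector field $X_t=\dot\phi_t\circ\phi_t^{-1}$, the flux form is $\Sigma(\Phi)=\int_0^1\phi_t^*(\iota_{X_t}\omega)\,dt$, and its de Rham class $\mathrm{Flux}(\Phi)=[\Sigma(\Phi)]\in H^1(T^2;\mathbb R)$ is the flux of $\Phi$. The flux group $\Gamma_\omega\subset H^1(T^2;\mathbb R)$ is the set of fluxes of all smooth symplectic loops at the identity ($\phi_0=\phi_1=\mathrm{Id}$). A vector field $A$ is called harmonic if $\iota_A\omega$ is a harmonic $1$-form. Let $\Phi$ be a smooth symplectic loop at the identity. Then: 1. The map $\mathbb Z^2\to H^1(T^2;\mathbb R)$, $(m,n)\mapsto m[dx]+n[dy]$, is an injective homomorphism with image $\Gamma_\omega$; thus $\Gamma_\omega\cong\mathbb Z^2$. 2. The flux form $\Sigma(\Phi)$ is smooth and closed,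 and the class $\mathrm{Flux}(\Phi)$ has a unique harmonic representative $\alpha$. There is a unique harmonic vector field $A$ with $\iota_A\omega=\alpha$; it is constant, and it has a unique flow $\{\psi_t\}_{t\in\mathbb R}$ ($\psi_0=\mathrm{Id}$, $\dot\psi_t=A\circ\psi_t$). 3. $\psi_1=\mathrm{Id}$ if and only if $\mathrm{Flux}(\Phi)\in\Gamma_\omega$. -/

import Mathlib

open scoped ContDiff Topology

noncomputable section

namespace TorusFlux

/-! ### The torus, its smooth structure and its tangent spaces -/

/-- The torus `ℝ² / ℤ²`. -/
abbrev Torus : Type := UnitAddCircle × UnitAddCircle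

/-- The covering projection `ℝ² → ℝ² / ℤ²`. -/
def proj (x : ℝ × ℝ) : Torus := ((x.1 : UnitAddCircle), (x.2 : UnitAddCircle))

/-- The representative of a point of the torus in the square `(-1/2, 1/2]²`. Near `0` this is the
inverse of `proj`, and `z ↦ coords (z - q)` is the standard flat chart of the torus centred at `q`.
Transition maps between these charts are locally translations, so the frame `∂/∂x, ∂/∂y`
is global and every tangent space of the torus is identified with `ℝ × ℝ` by means of it. -/
def coords (q : Torus) : ℝ × ℝ :=
  ((AddCircle.equivIoc (1 : ℝ) (-1 / 2) q.1 : ℝ), (AddCircle.equivIoc (1 : ℝ) (-1 / 2) q.2 : ℝ))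

theorem proj_coords (q : Torus) : proj (coords q) = q :=
  Prod.ext ((AddCircle.equivIoc (1 : ℝ) (-1 / 2)).symm_apply_apply q.1)
    ((AddCircle.equivIoc (1 : ℝ) (-1 / 2)).symm_apply_apply q.2)

/-- A function on the torus with values in a normed space is smooth if its `ℤ²`-periodic
pullback to `ℝ²` is smooth. -/
def SmoothFun {F : Type*} [NormedAddCommGroup F] [NormedSpace ℝ F] (f : Torus → F) : Prop :=
  ContDiff ℝ ∞ (fun x : ℝ × ℝ => f (proj x))

/-- A map into the torus, defined on a subset `S` of a normed space, is smooth on `S` if near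
every point of `S` it lifts along `proj` to a smooth map into `ℝ²`. -/
def SmoothIntoOn {X : Type*} [NormedAddCommGroup X] [NormedSpace ℝ X] (F : X → Torus)
    (S : Set X) : Prop :=
  ∀ x ∈ S, ∃ U : Set X, IsOpen U ∧ x ∈ U ∧
    ∃ g : X → ℝ × ℝ, ContDiffOn ℝ ∞ g (S ∩ U) ∧ ∀ y ∈ S ∩ U, proj (g y) = F y

/-- A self-map of the torus is smooth if it is so after composition with the covering. -/
def SmoothMap (F : Torus → Torus) : Prop :=
  SmoothIntoOn (fun x : ℝ × ℝ => F (proj x)) Set.univ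

/-- The differential `T_p T² → T_{F p} T²` of a self-map `F` of the torus, computed in the flat
charts centred at `p` and at `F p`. -/
def tangentMap (F : Torus → Torus) (p : Torus) : ℝ × ℝ →L[ℝ] ℝ × ℝ :=
  fderiv ℝ (fun v : ℝ × ℝ => coords (F (p + proj v) - F p)) 0

/-! ### Differential forms and de Rham cohomology in degree one -/

/-- One-forms on the torus (not necessarily smooth), written in the global frame. -/
def OneForm : Type := Torus → (ℝ × ℝ →L[ℝ] ℝ)

instance : AddCommGroup OneForm := inferInstanceAs (AddCommGroup (Torus → (ℝ × ℝ →L[ℝ] ℝ)))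

instance : Module ℝ OneForm := inferInstanceAs (Module ℝ (Torus → (ℝ × ℝ →L[ℝ] ℝ)))

/-- Vector fields on the torus, written in the global frame `∂/∂x, ∂/∂y`. -/
abbrev VField : Type := Torus → ℝ × ℝ

/-- The form `dx`. -/
def dx : OneForm := fun _ => ContinuousLinearMap.fst ℝ ℝ ℝ

/-- The form `dy`. -/
def dy : OneForm := fun _ => ContinuousLinearMap.snd ℝ ℝ ℝ

/-- The standard symplectic form `ω = dx ∧ dy` (at every point),
`ω (u, v) = u.1 * v.2 - u.2 * v.1`. -/
def omega : ℝ × ℝ →L[ℝ] ℝ × ℝ →L[ℝ] ℝ :=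
  (ContinuousLinearMap.fst ℝ ℝ ℝ).smulRight (ContinuousLinearMap.snd ℝ ℝ ℝ) -
    (ContinuousLinearMap.snd ℝ ℝ ℝ).smulRight (ContinuousLinearMap.fst ℝ ℝ ℝ)

theorem omega_apply (u v : ℝ × ℝ) : omega u v = u.1 * v.2 - u.2 * v.1 := by
  simp [omega]

/-- The contraction `ι_X ω`. -/
def contract (X : VField) : OneForm := fun p => omega (X p)

/-- The derivative of a one-form in the flat coordinates, at the point `proj x`:
`formDeriv α x u v = D_u (α v)`. -/
def formDeriv (α : OneForm) (x : ℝ × ℝ) : ℝ × ℝ →L[ℝ] ℝ × ℝ →L[ℝ] ℝ :=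
  fderiv ℝ (fun y : ℝ × ℝ => α (proj y)) x

/-- Smooth closed one-forms: `dα (u, v) = D_u (α v) - D_v (α u) = 0`. -/
def closedForms : Submodule ℝ OneForm where
  carrier := {α | SmoothFun α ∧ ∀ x u v, formDeriv α x u v - formDeriv α x v u = 0}
  zero_mem' := by
    refine ⟨contDiff_const, fun x u v => ?_⟩
    have h : formDeriv 0 x = 0 := fderiv_const_apply (0 : ℝ × ℝ →L[ℝ] ℝ)
    simp [h]
  add_mem' := by
    rintro α β ⟨hα, hα'⟩ ⟨hβ, hβ'⟩
    refine ⟨ContDiff.add hα hβ, fun x u v => ?_⟩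
    have h : formDeriv (α + β) x = formDeriv α x + formDeriv β x :=
      fderiv_add (hα.differentiable (by simp) x) (hβ.differentiable (by simp) x)
    have h1 := hα' x u v
    have h2 := hβ' x u v
    simp only [h, add_apply]
    linarith
  smul_mem' := by
    rintro c α ⟨hα, hα'⟩
    refine ⟨ContDiff.const_smul c hα, fun x u v => ?_⟩
    have h : formDeriv (c • α) x = c • formDeriv α x :=
      fderiv_const_smul (hα.differentiable (by simp) x) c
    simp only [h, smul_apply, smul_eq_mul]
    rw [← mul_sub, hα' x u v, mul_zero]

/-- Exact one-forms: the differentials `df` of smooth functions on the torus. -/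
def exactForms : Submodule ℝ OneForm where
  carrier := {α | ∃ f : Torus → ℝ, SmoothFun f ∧
    ∀ x : ℝ × ℝ, α (proj x) = fderiv ℝ (fun y : ℝ × ℝ => f (proj y)) x}
  zero_mem' := ⟨fun _ => 0, contDiff_const, fun _ => (fderiv_const_apply (0 : ℝ)).symm⟩
  add_mem' := by
    rintro α β ⟨f, hf, hf'⟩ ⟨g, hg, hg'⟩
    refine ⟨f + g, ContDiff.add hf hg, fun x => ?_⟩
    change α (proj x) + β (proj x) = _
    rw [hf' x, hg' x]
    exact (fderiv_add (hf.differentiable (by simp) x) (hg.differentiable (by simp) x)).symm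
  smul_mem' := by
    rintro c α ⟨f, hf, hf'⟩
    refine ⟨c • f, ContDiff.const_smul c hf, fun x => ?_⟩
    change c • α (proj x) = _
    rw [hf' x]
    exact (fderiv_const_smul (hf.differentiable (by simp) x) c).symm

/-- The de Rham cohomology `H¹(T²; ℝ)`: closed one-forms modulo exact one-forms. -/
abbrev H1 : Type := closedForms ⧸ exactForms.submoduleOf closedForms

/-- The cohomology class of a closed one-form. -/
def deRhamClass (α : OneForm) (h : α ∈ closedForms) : H1 :=
  Submodule.Quotient.mk ⟨α, h⟩

theorem dx_mem : dx ∈ closedForms :=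
  ⟨contDiff_const, fun x u v => by simp [formDeriv, dx]⟩

theorem dy_mem : dy ∈ closedForms :=
  ⟨contDiff_const, fun x u v => by simp [formDeriv, dy]⟩

/-- The homomorphism `ℤ² → H¹(T²; ℝ)`, `(m, n) ↦ m [dx] + n [dy]`. -/
def integralClass : ℤ × ℤ →+ H1 where
  toFun k := k.1 • deRhamClass dx dx_mem + k.2 • deRhamClass dy dy_mem
  map_zero' := by simp
  map_add' k l := by
    simp only [Prod.fst_add, Prod.snd_add, add_zsmul]
    abel

/-- The codifferential of a one-form `a dx + b dy` for the flat metric `dx² + dy²`, that is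
`-(∂a/∂x + ∂b/∂y)`, at the point `proj x`. -/
def codifferential (α : OneForm) (x : ℝ × ℝ) : ℝ :=
  -(formDeriv α x (1, 0) (1, 0) + formDeriv α x (0, 1) (0, 1))

/-- Harmonic one-forms for the flat metric: smooth, closed and co-closed. -/
def IsHarmonic (α : OneForm) : Prop :=
  α ∈ closedForms ∧ ∀ x, codifferential α x = 0

/-- `α` is a harmonic representative of the class `c`. -/
def IsHarmonicRep (α : OneForm) (c : H1) : Prop :=
  IsHarmonic α ∧ ∃ h : α ∈ closedForms, deRhamClass α h = c

/-- Harmonic vector fields: those whose contraction with `ω` is a harmonic one-form. -/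
def IsHarmonicField (A : VField) : Prop := IsHarmonic (contract A)

/-! ### Symplectic isotopies and flux -/

/-- A smooth symplectic isotopy `{φ_t}`, `t ∈ [0, 1]`, of `(T², dx ∧ dy)` starting at the identity.
The parameter is a real number for convenience; only the values `t ∈ [0, 1]` are ever used. -/
structure SymplecticIsotopy where
  /-- the maps `φ_t` -/
  map : ℝ → Torus ≃ Torus
  /-- `(t, p) ↦ φ_t p` is smooth on `[0, 1] × T²` -/
  smooth : SmoothIntoOn (fun z : ℝ × (ℝ × ℝ) => map z.1 (proj z.2))
    (Set.Icc (0 : ℝ) 1 ×ˢ Set.univ)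
  /-- the inverse of each `φ_t` is smooth -/
  smooth_symm : ∀ t ∈ Set.Icc (0 : ℝ) 1, SmoothMap (map t).symm
  /-- `φ_t^* ω = ω` -/
  symplectic : ∀ t ∈ Set.Icc (0 : ℝ) 1, ∀ (p : Torus) (u v : ℝ × ℝ),
    omega (tangentMap (map t) p u) (tangentMap (map t) p v) = omega u v
  /-- `φ_0 = id` -/
  map_zero : map 0 = Equiv.refl Torus

namespace SymplecticIsotopy

/-- A loop at the identity: `φ_1 = id` (and `φ_0 = id`). -/
def IsLoop (Φ : SymplecticIsotopy) : Prop := Φ.map 1 = Equiv.refl Torus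

/-- The velocity `d/dt φ_t (p)` (one-sided at the ends of `[0, 1]`), a tangent vector at `φ_t p`,
computed in the flat chart centred at `φ_t p`. -/
def velocity (Φ : SymplecticIsotopy) (t : ℝ) (p : Torus) : ℝ × ℝ :=
  derivWithin (fun s : ℝ => coords (Φ.map s p - Φ.map t p)) (Set.Icc 0 1) t

/-- The generating vector field `X_t`, with `X_t = (d/dt φ_t) ∘ φ_t⁻¹`. -/
def generator (Φ : SymplecticIsotopy) (t : ℝ) : VField :=
  fun q => Φ.velocity t ((Φ.map t).symm q)

/-- The pullback `F^* α` of a one-form. -/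
def _root_.TorusFlux.pullback (F : Torus → Torus) (α : OneForm) : OneForm :=
  fun p => (α (F p)).comp (tangentMap F p)

/-- The flux form `Σ(Φ) = ∫₀¹ φ_t^* (ι_{X_t} ω) dt`. -/
def fluxForm (Φ : SymplecticIsotopy) : OneForm :=
  fun p => ∫ t in (0 : ℝ)..1, pullback (Φ.map t) (contract (Φ.generator t)) p

open Classical in
/-- The flux of `Φ`: the cohomology class of its flux form. The flux form of a symplectic
isotopy is always closed, so the default value `0` is never used. -/
def flux (Φ : SymplecticIsotopy) : H1 :=
  if h : Φ.fluxForm ∈ closedForms then deRhamClass Φ.fluxForm h else 0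

end SymplecticIsotopy

/-- The flux group `Γ_ω`: the fluxes of all smooth symplectic loops at the identity. -/
def fluxGroup : Set H1 := {c | ∃ Φ : SymplecticIsotopy, Φ.IsLoop ∧ Φ.flux = c}

/-- `ψ` is the flow of the vector field `A`: `ψ_0 = id` and `d/dt ψ_t (p) = A (ψ_t p)`, the
derivative being computed in the flat chart centred at `ψ_t p`. -/
def IsFlow (A : VField) (ψ : ℝ → Torus → Torus) : Prop :=
  (∀ p, ψ 0 p = p) ∧
    ∀ t p, HasDerivAt (fun s : ℝ => coords (ψ s p - ψ t p)) (A (ψ t p)) t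

end TorusFlux

end

noncomputable section

namespace TorusFlux

/-! ### Smooth dependence of integrals on parameters -/

section Parametric

universe u

variable {E F : Type u} [NormedAddCommGroup E] [NormedSpace ℝ E]
  [NormedAddCommGroup F] [NormedSpace ℝ F]

/-! A loop lifts to the plane as a path of maps starting at the identity and commuting with lattice
translations; it ends at the translation by some lattice vector `k` (`IsLoop.exists_lift_one`). The
period of the flux form along a lattice vector `l` is the `ω`-area swept out by the segment from `0`
to `l` under the lift. By Green's formula this area depends only on the boundary of the swept
square, and equals `ω(k, l)` (`integral_omega_eq_of_square`, `integral_fluxForm_lattice`). A closed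
form on the torus is determined up to exact forms by its periods, so the flux is the class of the
constant form `ι_k ω` (`IsLoop.exists_flux_eq`). Translation loops realise every `k`, which
identifies the flux group with the integral classes.

Harmonic forms are constant by Liouville's theorem (`IsHarmonic.eq_constForm`), and distinct
constant forms are not cohomologous. So the harmonic representative is `ι_k ω`, its field is the
constant `k`, and the flow is `p ↦ p + proj (t • k)`, which is the identity at time `1`.

The isotopy is smooth only on `[0, 1]`. Running it through the smooth time change `clock` gives a
lift smooth on all of `ℝ × ℝ²`, with no change in the flux integral (`fluxForm_proj`). -/

theorem hasFDerivAt_parametric_intervalIntegral [FiniteDimensional ℝ E] {f : E → ℝ → F}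
    (hf : ContDiff ℝ 1 (fun z : E × ℝ => f z.1 z.2)) (a b : ℝ) (x : E) :
    HasFDerivAt (fun y => ∫ t in a..b, f y t) (∫ t in a..b, fderiv ℝ (fun y => f y t) x) x := by
  have hd : ∀ y t, HasFDerivAt (fun y => f y t)
      ((fderiv ℝ (fun z : E × ℝ => f z.1 z.2) (y, t)).comp (ContinuousLinearMap.inl ℝ E ℝ)) y :=
    fun y t => HasFDerivAt.comp (g := fun z : E × ℝ => f z.1 z.2) (f := fun y => (y, t)) y
      ((hf.differentiable (by simp) (y, t)).hasFDerivAt) (hasFDerivAt_prodMk_left y t)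
  have hc : Continuous (fun z : E × ℝ => fderiv ℝ (fun y => f y z.2) z.1) := by
    simp only [fun y t => (hd y t).fderiv]
    exact (ContinuousLinearMap.compL ℝ E (E × ℝ) F).flip
      (ContinuousLinearMap.inl ℝ E ℝ) |>.continuous.comp (hf.continuous_fderiv (by simp))
  -- Compactness of ball times interval turns continuity of the partial derivative into a constant
  -- dominating bound.
  obtain ⟨C, hC⟩ := ((isCompact_closedBall x 1).prod
    (isCompact_uIcc (a := a) (b := b))).exists_bound_of_continuousOn hc.continuousOn
  refine (intervalIntegral.hasFDerivAt_integral_of_dominated_of_fderiv_le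
    (bound := fun _ => C) (F' := fun y t => fderiv ℝ (fun y => f y t) y)
    (Metric.ball_mem_nhds x one_pos) ?_ ?_ ?_ ?_ ?_ ?_)
  · exact Filter.Eventually.of_forall fun y =>
      (hf.continuous.comp (by fun_prop : Continuous fun t : ℝ => (y, t))).aestronglyMeasurable
  · exact (hf.continuous.comp
      (by fun_prop : Continuous fun t : ℝ => (x, t))).intervalIntegrable _ _
  · exact (hc.comp (by fun_prop : Continuous fun t : ℝ => (x, t))).aestronglyMeasurable
  · exact Filter.Eventually.of_forall fun t ht y hy =>
      hC (y, t) ⟨Metric.ball_subset_closedBall hy, Set.uIoc_subset_uIcc ht⟩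
  · exact intervalIntegrable_const
  · exact Filter.Eventually.of_forall fun t _ y _ =>
      (hd y t).differentiableAt.hasFDerivAt

theorem contDiff_partial_fderiv {f : E → ℝ → F} {n m : WithTop ℕ∞}
    (hf : ContDiff ℝ m (fun z : E × ℝ => f z.1 z.2)) (h : n + 1 ≤ m) :
    ContDiff ℝ n (fun z : E × ℝ => fderiv ℝ (fun y => f y z.2) z.1) := by
  have hm : m ≠ 0 := by
    rintro rfl
    simp at h
  have hd : ∀ y t, fderiv ℝ (fun y => f y t) y =
      ((fderiv ℝ (fun z : E × ℝ => f z.1 z.2) (y, t)).comp (ContinuousLinearMap.inl ℝ E ℝ)) :=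
    fun y t => (HasFDerivAt.comp (g := fun z : E × ℝ => f z.1 z.2) (f := fun y => (y, t)) y
      ((hf.differentiable hm (y, t)).hasFDerivAt) (hasFDerivAt_prodMk_left y t)).fderiv
  simp only [hd]
  exact (hf.fderiv_right h).clm_comp contDiff_const

theorem continuous_partial_fderiv {f : E → ℝ → F}
    (hf : ContDiff ℝ ∞ (fun z : E × ℝ => f z.1 z.2)) (x : E) :
    Continuous fun t => fderiv ℝ (fun y => f y t) x :=
  (contDiff_partial_fderiv (n := ∞) hf (by simp)).continuous.comp (Continuous.prodMk_right x)

/-- Induction on `n` by differentiating under the integral. The target `F` is quantified inside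
because the derivative takes values in `E →L[ℝ] F`. -/
theorem contDiff_nat_parametric_intervalIntegral [FiniteDimensional ℝ E] (n : ℕ) (a b : ℝ) :
    ∀ {F : Type u} [NormedAddCommGroup F] [NormedSpace ℝ F] {f : E → ℝ → F},
      ContDiff ℝ n (fun z : E × ℝ => f z.1 z.2) → ContDiff ℝ n (fun y => ∫ t in a..b, f y t) := by
  induction n with
  | zero =>
    intro F _ _ f hf
    simp only [Nat.cast_zero, contDiff_zero] at hf ⊢
    exact intervalIntegral.continuous_parametric_intervalIntegral_of_continuous' hf a b
  | succ n ih =>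
    intro F _ _ f hf
    have h1 : ContDiff ℝ 1 (fun z : E × ℝ => f z.1 z.2) :=
      hf.of_le (by exact_mod_cast Nat.le_add_left 1 n)
    rw [Nat.cast_succ]
    exact contDiff_succ_iff_hasFDerivAt.2
      ⟨fun y => ∫ t in a..b, fderiv ℝ (fun y => f y t) y,
        ih (f := fun y t => fderiv ℝ (fun y => f y t) y) (contDiff_partial_fderiv hf (by simp)),
        fun x => hasFDerivAt_parametric_intervalIntegral h1 a b x⟩

theorem contDiff_parametric_intervalIntegral [FiniteDimensional ℝ E] {f : E → ℝ → F}
    (hf : ContDiff ℝ ∞ (fun z : E × ℝ => f z.1 z.2)) (a b : ℝ) :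
    ContDiff ℝ ∞ (fun y => ∫ t in a..b, f y t) :=
  contDiff_infty.2 fun n => contDiff_nat_parametric_intervalIntegral n a b (contDiff_infty.1 hf n)

end Parametric

/-- Primitives in the time variable depend smoothly on time and on the parameter. -/
theorem contDiff_primitive {W : ℝ → ℝ × ℝ → ℝ × ℝ}
    (hW : ContDiff ℝ ∞ (fun z : ℝ × (ℝ × ℝ) => W z.1 z.2)) :
    ContDiff ℝ ∞ (fun z : ℝ × (ℝ × ℝ) => ∫ r in (0 : ℝ)..z.1, W r z.2) := by
  have h : ∀ z : ℝ × (ℝ × ℝ), ∫ r in (0 : ℝ)..z.1, W r z.2 =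
      -- Rescaling by `r = z.1 * u` moves the variable endpoint into the integrand.
      z.1 • ∫ u in (0 : ℝ)..1, W (z.1 * u) z.2 := fun z => by
    rw [intervalIntegral.smul_integral_comp_mul_left (fun r => W r z.2)]
    simp
  simp only [h]
  refine contDiff_fst.smul (contDiff_parametric_intervalIntegral
    (f := fun (z : ℝ × (ℝ × ℝ)) u => W (z.1 * u) z.2) ?_ 0 1)
  exact hW.comp (by fun_prop : ContDiff ℝ ∞ fun z : (ℝ × (ℝ × ℝ)) × ℝ => (z.1.1 * z.2, z.1.2))

/-! ### The covering projection and the flat charts -/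

theorem proj_add (x y : ℝ × ℝ) : proj (x + y) = proj x + proj y := rfl

theorem proj_sub (x y : ℝ × ℝ) : proj (x - y) = proj x - proj y := rfl

theorem proj_zero : proj 0 = 0 := rfl

/-- The inclusion of the integral lattice. -/
def lattice (k : ℤ × ℤ) : ℝ × ℝ := (k.1, k.2)

theorem proj_eq_zero_iff {x : ℝ × ℝ} : proj x = 0 ↔ ∃ k, lattice k = x := by
  have h : ∀ r : ℝ, (r : UnitAddCircle) = 0 ↔ ∃ n : ℤ, (n : ℝ) = r := fun r => by
    simp [AddSubgroup.mem_zmultiples_iff]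
  constructor
  · intro hx
    obtain ⟨m, hm⟩ := (h _).1 (congrArg Prod.fst hx)
    obtain ⟨n, hn⟩ := (h _).1 (congrArg Prod.snd hx)
    exact ⟨(m, n), Prod.ext hm hn⟩
  · rintro ⟨k, rfl⟩
    exact Prod.ext ((h _).2 ⟨k.1, rfl⟩) ((h _).2 ⟨k.2, rfl⟩)

theorem proj_lattice (k : ℤ × ℤ) : proj (lattice k) = 0 :=
  proj_eq_zero_iff.2 ⟨k, rfl⟩

theorem proj_add_lattice (x : ℝ × ℝ) (k : ℤ × ℤ) : proj (x + lattice k) = proj x := by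
  rw [proj_add, proj_lattice, add_zero]

theorem proj_surjective : Function.Surjective proj := fun q => ⟨coords q, proj_coords q⟩

theorem norm_proj_le (x : ℝ × ℝ) : ‖proj x‖ ≤ ‖x‖ := by
  have h : ∀ r : ℝ, ‖(r : UnitAddCircle)‖ ≤ ‖r‖ := fun r => by
    rw [UnitAddCircle.norm_eq, Real.norm_eq_abs]
    simpa using round_le r 0
  exact max_le_max (h x.1) (h x.2)

theorem coords_proj {x : ℝ × ℝ} (hx : ‖x‖ < 1 / 2) : coords (proj x) = x := by
  have h : ∀ r : ℝ, ‖r‖ ≤ ‖x‖ →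
      ((AddCircle.equivIoc (1 : ℝ) (-1 / 2) (r : UnitAddCircle) : Set.Ioc _ _) : ℝ) = r :=
    fun r hr => by
      have := abs_lt.1 (hr.trans_lt hx)
      exact AddCircle.equivIoc_coe_of_mem (p := (1 : ℝ)) (a := -1 / 2)
        ⟨by linarith [this.1], by linarith [this.2]⟩
  exact Prod.ext (h _ (norm_fst_le x)) (h _ (norm_snd_le x))

theorem coords_zero : coords 0 = 0 := by
  rw [← proj_zero, coords_proj (by simp)]

theorem eventually_coords_proj : ∀ᶠ x : ℝ × ℝ in 𝓝 0, coords (proj x) = x := by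
  filter_upwards [Metric.ball_mem_nhds (0 : ℝ × ℝ) (by norm_num : (0 : ℝ) < 1 / 2)] with x hx
  exact coords_proj (by simpa using hx)

/-- The differential of a self-map of the torus is that of any lift. -/
theorem tangentMap_proj {F : Torus → Torus} {g : ℝ × ℝ → ℝ × ℝ} {x : ℝ × ℝ}
    (hg : DifferentiableAt ℝ g x) (hF : ∀ᶠ y in 𝓝 x, F (proj y) = proj (g y)) :
    tangentMap F (proj x) = fderiv ℝ g x := by
  have ht : Filter.Tendsto (fun v : ℝ × ℝ => x + v) (𝓝 0) (𝓝 x) := by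
    have : Continuous fun v : ℝ × ℝ => x + v := by fun_prop
    simpa using this.tendsto 0
  have h0 : Filter.Tendsto (fun v : ℝ × ℝ => g (x + v) - g x) (𝓝 0) (𝓝 0) := by
    simpa using (hg.continuousAt.tendsto.comp ht).sub_const (g x)
  have h : (fun v : ℝ × ℝ => coords (F (proj x + proj v) - F (proj x)))
      =ᶠ[𝓝 0] fun v => g (x + v) - g x := by
    filter_upwards [ht.eventually hF, h0.eventually eventually_coords_proj] with v h1 h2
    rw [← proj_add, h1, hF.self_of_nhds, ← proj_sub, h2]
  rw [tangentMap, h.fderiv_eq, fderiv_sub_const, fderiv_comp_add_left, add_zero]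

/-- The velocity of a path in the torus is that of any lift. -/
theorem hasDerivWithinAt_coords {c : ℝ → Torus} {g : ℝ → ℝ × ℝ} {s : Set ℝ} {t : ℝ} {v : ℝ × ℝ}
    (hg : HasDerivWithinAt g v s t) (hc : ∀ᶠ r in 𝓝[s] t, c r = proj (g r))
    (ht : c t = proj (g t)) :
    HasDerivWithinAt (fun r => coords (c r - c t)) v s t := by
  have h0 : Filter.Tendsto (fun r => g r - g t) (𝓝[s] t) (𝓝 0) := by
    simpa using hg.continuousWithinAt.tendsto.sub_const (g t)
  refine (hg.sub_const (g t)).congr_of_eventuallyEq ?_ ?_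
  · filter_upwards [hc, h0.eventually eventually_coords_proj] with r h1 h2
    rw [h1, ht, ← proj_sub, h2]
  · rw [sub_self, sub_self, coords_zero]

/-- A path in the torus is determined by its velocity and its initial point. -/
theorem eq_proj_of_hasDerivWithinAt {c : ℝ → Torus} {g v : ℝ → ℝ × ℝ} {s : Set ℝ}
    (hs : Convex ℝ s) (hc : ∀ t ∈ s, HasDerivWithinAt (fun r => coords (c r - c t)) (v t) s t)
    (hg : ∀ t ∈ s, HasDerivWithinAt g (v t) s t) {a : ℝ} (ha : a ∈ s) (h0 : c a = proj (g a))
    {t : ℝ} (ht : t ∈ s) : c t = proj (g t) := by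
  set d : ℝ → Torus := fun r => c r - proj (g r) with hd
  -- Since `proj` does not increase norms, increments of `‖d‖` are bounded by the difference of the
  -- increments of the two paths in the plane, which is `o(r - t)`.
  have key : ∀ t ∈ s, HasDerivWithinAt (fun r => ‖d r‖) 0 s t := by
    intro t ht
    have h1 := ((hc t ht).sub (hg t ht)).isLittleO
    rw [hasDerivWithinAt_iff_isLittleO]
    refine Asymptotics.IsBigO.trans_isLittleO (Asymptotics.IsBigO.of_bound 1 ?_) h1
    refine Filter.Eventually.of_forall fun r => ?_
    have h2 : d r - d t = proj (coords (c r - c t) - (g r - g t)) := by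
      rw [proj_sub, proj_coords, proj_sub]
      exact sub_sub_sub_comm _ _ _ _
    have h3 : ‖‖d r‖ - ‖d t‖‖ ≤ ‖coords (c r - c t) - (g r - g t)‖ :=
      (abs_norm_sub_norm_le _ _).trans (h2 ▸ norm_proj_le _)
    simpa [coords_zero, sub_sub_sub_comm, sub_sub, sub_add] using h3
  have h := hs.norm_image_sub_le_of_norm_hasDerivWithin_le (C := 0) key (by simp) ha ht
  have : d t = 0 := by
    simpa [hd, h0, sub_eq_zero] using h
  exact sub_eq_zero.1 this

/-! ### The lift of a symplectic isotopy to the plane -/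

namespace SymplecticIsotopy

variable (Φ : SymplecticIsotopy)

/-- The domain of the lift of an isotopy. -/
abbrev strip : Set (ℝ × (ℝ × ℝ)) := Set.Icc (0 : ℝ) 1 ×ˢ Set.univ

theorem uniqueDiffOn_strip : UniqueDiffOn ℝ strip :=
  (uniqueDiffOn_Icc zero_lt_one).prod uniqueDiffOn_univ

/-- Near every point, velocities and tangent maps are read off from a smooth local lift. -/
theorem exists_local_derivative {z : ℝ × (ℝ × ℝ)} (hz : z ∈ strip) :
    ∃ U : Set (ℝ × (ℝ × ℝ)), IsOpen U ∧ z ∈ U ∧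
      ∃ D : ℝ × (ℝ × ℝ) → (ℝ × (ℝ × ℝ) →L[ℝ] ℝ × ℝ), ContDiffOn ℝ ∞ D (strip ∩ U) ∧
        ∀ w ∈ strip ∩ U,
          HasDerivWithinAt (fun s => coords (Φ.map s (proj w.2) - Φ.map w.1 (proj w.2)))
            (D w (1, 0)) (Set.Icc 0 1) w.1 ∧
          tangentMap (Φ.map w.1) (proj w.2) =
            (D w).comp (ContinuousLinearMap.inr ℝ ℝ (ℝ × ℝ)) := by
  obtain ⟨U, hU, hzU, g, hg, hgF⟩ := Φ.smooth z hz
  refine ⟨U, hU, hzU, fderivWithin ℝ g (strip ∩ U),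
    hg.fderivWithin (uniqueDiffOn_strip.inter hU) (by simp), fun w hw => ?_⟩
  have hd : HasFDerivWithinAt g (fderivWithin ℝ g (strip ∩ U) w) strip w :=
    (hasFDerivWithinAt_inter (hU.mem_nhds hw.2)).1
      ((hg.differentiableOn (by simp) w hw).hasFDerivWithinAt)
  constructor
  · have hp : HasDerivWithinAt (fun s : ℝ => (s, w.2)) ((1 : ℝ), (0 : ℝ × ℝ)) (Set.Icc 0 1) w.1 :=
      ((hasDerivAt_id w.1).prodMk (hasDerivAt_const w.1 w.2)).hasDerivWithinAt
    have hm : Set.MapsTo (fun s : ℝ => (s, w.2)) (Set.Icc 0 1) strip :=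
      fun s hs => ⟨hs, Set.mem_univ _⟩
    refine hasDerivWithinAt_coords (g := fun s => g (s, w.2))
      (HasFDerivWithinAt.comp_hasDerivWithinAt (l := g) w.1 hd hp hm) ?_ (hgF w hw).symm
    have : ∀ᶠ r in 𝓝[Set.Icc 0 1] w.1, (r, w.2) ∈ U :=
      hp.continuousWithinAt.eventually (hU.mem_nhds hw.2)
    filter_upwards [this, self_mem_nhdsWithin] with r h1 h2
    exact (hgF (r, w.2) ⟨hm h2, h1⟩).symm
  · have hm : Set.MapsTo (fun y : ℝ × ℝ => (w.1, y)) Set.univ strip :=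
      fun y _ => ⟨hw.1.1, Set.mem_univ _⟩
    have h1 : HasFDerivAt (fun y => g (w.1, y)) _ w.2 := hasFDerivWithinAt_univ.1
      (HasFDerivWithinAt.comp (g := g) w.2 hd
        (hasFDerivAt_prodMk_right (𝕜 := ℝ) w.1 w.2).hasFDerivWithinAt hm)
    rw [← h1.fderiv]
    refine tangentMap_proj h1.differentiableAt ?_
    have : ∀ᶠ y in 𝓝 w.2, (w.1, y) ∈ U :=
      (by fun_prop : Continuous fun y : ℝ × ℝ => (w.1, y)).continuousAt.eventually
        (hU.mem_nhds hw.2)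
    filter_upwards [this] with y hy
    exact (hgF (w.1, y) ⟨hm (Set.mem_univ y), hy⟩).symm

theorem hasDerivWithinAt_velocity {t : ℝ} (ht : t ∈ Set.Icc (0 : ℝ) 1) (x : ℝ × ℝ) :
    HasDerivWithinAt (fun s => coords (Φ.map s (proj x) - Φ.map t (proj x)))
      (Φ.velocity t (proj x)) (Set.Icc 0 1) t := by
  obtain ⟨U, -, hzU, D, -, hD⟩ := Φ.exists_local_derivative (z := (t, x)) ⟨ht, Set.mem_univ x⟩
  exact (hD (t, x) ⟨⟨ht, Set.mem_univ x⟩, hzU⟩).1.differentiableWithinAt.hasDerivWithinAt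

theorem contDiffOn_velocity :
    ContDiffOn ℝ ∞ (fun z : ℝ × (ℝ × ℝ) => Φ.velocity z.1 (proj z.2)) strip := by
  refine contDiffOn_of_locally_contDiffOn fun z hz => ?_
  obtain ⟨U, hU, hzU, D, hDs, hD⟩ := Φ.exists_local_derivative hz
  refine ⟨U, hU, hzU, (hDs.clm_apply (contDiffOn_const (c := ((1 : ℝ), (0 : ℝ × ℝ))))).congr
    fun w hw => ?_⟩
  exact (hD w hw).1.derivWithin (uniqueDiffOn_Icc zero_lt_one _ hw.1.1)

theorem contDiffOn_tangentMap :
    ContDiffOn ℝ ∞ (fun z : ℝ × (ℝ × ℝ) => tangentMap (Φ.map z.1) (proj z.2)) strip := by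
  refine contDiffOn_of_locally_contDiffOn fun z hz => ?_
  obtain ⟨U, hU, hzU, D, hDs, hD⟩ := Φ.exists_local_derivative hz
  exact ⟨U, hU, hzU, (hDs.clm_comp (contDiffOn_const
    (c := ContinuousLinearMap.inr ℝ ℝ (ℝ × ℝ)))).congr fun w hw => (hD w hw).2⟩

/-- A reparametrisation of `[0, 1]` which is defined and smooth on the line. -/
abbrev clock : ℝ → ℝ := Real.smoothTransition

theorem contDiff_clock : ContDiff ℝ ∞ clock := Real.smoothTransition.contDiff

theorem clock_mem (s : ℝ) : clock s ∈ Set.Icc (0 : ℝ) 1 :=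
  ⟨Real.smoothTransition.nonneg s, Real.smoothTransition.le_one s⟩

theorem hasDerivAt_clock (s : ℝ) : HasDerivAt clock (deriv clock s) s :=
  (contDiff_clock.differentiable (by simp) s).hasDerivAt

theorem contDiff_clockMap :
    ContDiff ℝ ∞ (fun z : ℝ × (ℝ × ℝ) => (clock z.1, z.2)) :=
  (contDiff_clock.comp contDiff_fst).prodMk contDiff_snd

/-- The velocity of the reparametrised isotopy. -/
def liftVelocity (s : ℝ) (x : ℝ × ℝ) : ℝ × ℝ := deriv clock s • Φ.velocity (clock s) (proj x)

theorem contDiff_liftVelocity :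
    ContDiff ℝ ∞ (fun z : ℝ × (ℝ × ℝ) => Φ.liftVelocity z.1 z.2) := by
  have h1 : ContDiff ℝ ∞ (deriv clock) := (contDiff_infty_iff_deriv.1 contDiff_clock).2
  refine (h1.comp contDiff_fst).smul ?_
  rw [← contDiffOn_univ]
  exact Φ.contDiffOn_velocity.comp contDiff_clockMap.contDiffOn
    fun z _ => ⟨clock_mem z.1, Set.mem_univ _⟩

/-- The lift to the plane of the reparametrised isotopy, starting at the identity. -/
def lift (s : ℝ) (x : ℝ × ℝ) : ℝ × ℝ := x + ∫ r in (0 : ℝ)..s, Φ.liftVelocity r x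

theorem contDiff_lift : ContDiff ℝ ∞ (fun z : ℝ × (ℝ × ℝ) => Φ.lift z.1 z.2) :=
  contDiff_snd.add (contDiff_primitive Φ.contDiff_liftVelocity)

theorem lift_zero (x : ℝ × ℝ) : Φ.lift 0 x = x := by
  simp [lift]

/-- The displacement integrates a velocity that depends on `x` only through `proj x`. -/
theorem lift_add_lattice (s : ℝ) (x : ℝ × ℝ) (k : ℤ × ℤ) :
    Φ.lift s (x + lattice k) = Φ.lift s x + lattice k := by
  simp only [lift, liftVelocity, proj_add_lattice]
  abel

theorem hasDerivAt_lift (s : ℝ) (x : ℝ × ℝ) :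
    HasDerivAt (fun r => Φ.lift r x) (Φ.liftVelocity s x) s := by
  have hc : Continuous fun r => Φ.liftVelocity r x :=
    Φ.contDiff_liftVelocity.continuous.comp (by fun_prop : Continuous fun r : ℝ => (r, x))
  exact (intervalIntegral.integral_hasDerivAt_right (hc.intervalIntegrable _ _)
    hc.aestronglyMeasurable.stronglyMeasurableAtFilter hc.continuousAt).const_add x

/-- Both paths start at `proj x` and have velocity `liftVelocity`, by the chain rule through
`clock`. -/
theorem proj_lift (s : ℝ) (x : ℝ × ℝ) : Φ.map (clock s) (proj x) = proj (Φ.lift s x) := by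
  refine eq_proj_of_hasDerivWithinAt (c := fun s => Φ.map (clock s) (proj x))
    (g := fun s => Φ.lift s x) (v := fun s => Φ.liftVelocity s x) (s := Set.univ) (a := 0)
    convex_univ (fun t _ => ?_) (fun t _ => (Φ.hasDerivAt_lift t x).hasDerivWithinAt)
    (Set.mem_univ _) ?_ (Set.mem_univ s)
  · exact HasDerivWithinAt.scomp (h := clock)
      (g₁ := fun r => coords (Φ.map r (proj x) - Φ.map (clock t) (proj x))) t
      (Φ.hasDerivWithinAt_velocity (clock_mem t) x) (hasDerivAt_clock t).hasDerivWithinAt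
      (fun r _ => clock_mem r)
  · simp [clock, Φ.map_zero, lift_zero]

theorem differentiableAt_lift (s : ℝ) (x : ℝ × ℝ) : DifferentiableAt ℝ (Φ.lift s) x := by
  have h : ContDiff ℝ ∞ (fun y => Φ.lift s y) :=
    Φ.contDiff_lift.comp (by fun_prop : ContDiff ℝ ∞ fun y : ℝ × ℝ => (s, y))
  exact h.differentiable (by simp) x

theorem tangentMap_clock (s : ℝ) (x : ℝ × ℝ) :
    tangentMap (Φ.map (clock s)) (proj x) = fderiv ℝ (Φ.lift s) x :=
  tangentMap_proj (Φ.differentiableAt_lift s x)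
    (Filter.Eventually.of_forall fun y => Φ.proj_lift s y)

theorem omega_fderiv_lift (s : ℝ) (x u v : ℝ × ℝ) :
    omega (fderiv ℝ (Φ.lift s) x u) (fderiv ℝ (Φ.lift s) x v) = omega u v := by
  rw [← tangentMap_clock]
  exact Φ.symplectic _ (clock_mem s) _ u v

/-- The time-one lift covers the identity, so its differential is the identity and the displacement
is constant; its value at `0` projects to `0`. -/
theorem IsLoop.exists_lift_one {Φ : SymplecticIsotopy} (hΦ : Φ.IsLoop) :
    ∃ k, ∀ x, Φ.lift 1 x = x + lattice k := by
  have hp : ∀ x, proj (Φ.lift 1 x) = proj x := fun x => by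
    rw [← proj_lift, clock, Real.smoothTransition.one, hΦ]
    rfl
  have hf : ∀ x, HasFDerivAt (fun x => Φ.lift 1 x - x) (0 : ℝ × ℝ →L[ℝ] ℝ × ℝ) x := fun x => by
    have h1 : fderiv ℝ (Φ.lift 1) x = ContinuousLinearMap.id ℝ (ℝ × ℝ) := by
      rw [← tangentMap_clock, clock, Real.smoothTransition.one, hΦ,
        tangentMap_proj (g := id) differentiableAt_id (Filter.Eventually.of_forall fun y => rfl),
        fderiv_id]
    have h2 := (Φ.differentiableAt_lift 1 x).hasFDerivAt.sub (hasFDerivAt_id x)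
    rw [h1, sub_self] at h2
    exact h2
  obtain ⟨k, hk⟩ := (proj_eq_zero_iff (x := Φ.lift 1 0 - 0)).1 (by rw [proj_sub, hp, sub_self])
  refine ⟨k, fun x => ?_⟩
  rw [hk, is_const_of_fderiv_eq_zero (𝕜 := ℝ) (fun y => (hf y).differentiableAt)
    (fun y => (hf y).fderiv) 0 x]
  abel

/-- The form `φ_t^* (ι_{X_t} ω)` at the point `proj x`. -/
def fluxDensity (x : ℝ × ℝ) (t : ℝ) : ℝ × ℝ →L[ℝ] ℝ :=
  (omega (Φ.velocity t (proj x))).comp (tangentMap (Φ.map t) (proj x))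

theorem continuousOn_fluxDensity (x : ℝ × ℝ) :
    ContinuousOn (Φ.fluxDensity x) (Set.Icc 0 1) := by
  have hm : Set.MapsTo (fun t : ℝ => (t, x)) (Set.Icc 0 1) strip :=
    fun t ht => ⟨ht, Set.mem_univ _⟩
  have hi : ContinuousOn (fun t : ℝ => (t, x)) (Set.Icc 0 1) :=
    (Continuous.prodMk_left x).continuousOn
  have h1 : ContinuousOn (fun t => Φ.velocity t (proj x)) (Set.Icc 0 1) :=
    ContinuousOn.comp (g := fun z : ℝ × (ℝ × ℝ) => Φ.velocity z.1 (proj z.2))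
      (f := fun t : ℝ => (t, x)) Φ.contDiffOn_velocity.continuousOn hi hm
  have h2 : ContinuousOn (fun t => tangentMap (Φ.map t) (proj x)) (Set.Icc 0 1) :=
    ContinuousOn.comp (g := fun z : ℝ × (ℝ × ℝ) => tangentMap (Φ.map z.1) (proj z.2))
      (f := fun t : ℝ => (t, x)) Φ.contDiffOn_tangentMap.continuousOn hi hm
  exact (omega.continuous.comp_continuousOn h1).clm_comp h2

theorem fluxForm_eq_integral_fluxDensity (x : ℝ × ℝ) :
    Φ.fluxForm (proj x) = ∫ t in (0 : ℝ)..1, Φ.fluxDensity x t := by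
  refine intervalIntegral.integral_congr fun t _ => ?_
  simp [fluxDensity, pullback, contract, generator]

/-- The flux form in terms of the lift of the isotopy. -/
theorem fluxForm_proj (x : ℝ × ℝ) : Φ.fluxForm (proj x) =
    ∫ s in (0 : ℝ)..1, (omega (Φ.liftVelocity s x)).comp (fderiv ℝ (Φ.lift s) x) := by
  -- Substitution `t = clock s`; the factor `deriv clock s` is the one built into `liftVelocity`.
  have h := intervalIntegral.integral_deriv_smul_comp'' (a := 0) (b := 1)
    (f := clock) (f' := deriv clock) (g := Φ.fluxDensity x)
    contDiff_clock.continuous.continuousOn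
    (fun s _ => (hasDerivAt_clock s).hasDerivWithinAt)
    ((contDiff_clock.continuous_deriv (by simp)).continuousOn)
    ((Φ.continuousOn_fluxDensity x).mono (by rintro _ ⟨s, -, rfl⟩; exact clock_mem s))
  rw [clock, Real.smoothTransition.zero, Real.smoothTransition.one] at h
  rw [fluxForm_eq_integral_fluxDensity, ← h]
  refine intervalIntegral.integral_congr fun s _ => ?_
  simp only [fluxDensity, Function.comp_apply, tangentMap_clock, liftVelocity, map_smul]
  rfl

end SymplecticIsotopy

namespace SymplecticIsotopy

variable (Φ : SymplecticIsotopy)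

/-! ### The flux form is closed -/

theorem contDiff_swap_lift : ContDiff ℝ ∞ (fun z : (ℝ × ℝ) × ℝ => Φ.lift z.2 z.1) :=
  Φ.contDiff_lift.comp (contDiff_snd.prodMk contDiff_fst)

theorem contDiff_swap_liftVelocity :
    ContDiff ℝ ∞ (fun z : (ℝ × ℝ) × ℝ => Φ.liftVelocity z.2 z.1) :=
  Φ.contDiff_liftVelocity.comp (contDiff_snd.prodMk contDiff_fst)

theorem contDiff_fderiv_lift :
    ContDiff ℝ ∞ (fun z : (ℝ × ℝ) × ℝ => fderiv ℝ (Φ.lift z.2) z.1) :=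
  contDiff_partial_fderiv (f := fun y s => Φ.lift s y) Φ.contDiff_swap_lift (by simp)

/-- The form whose time integral is the flux form. -/
def fluxIntegrand (y : ℝ × ℝ) (s : ℝ) : ℝ × ℝ →L[ℝ] ℝ :=
  (omega (Φ.liftVelocity s y)).comp (fderiv ℝ (Φ.lift s) y)

theorem contDiff_fluxIntegrand :
    ContDiff ℝ ∞ (fun z : (ℝ × ℝ) × ℝ => Φ.fluxIntegrand z.1 z.2) :=
  (omega.contDiff.comp Φ.contDiff_swap_liftVelocity).clm_comp Φ.contDiff_fderiv_lift

theorem fluxForm_comp_proj :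
    (fun y => Φ.fluxForm (proj y)) = fun y => ∫ s in (0 : ℝ)..1, Φ.fluxIntegrand y s :=
  funext Φ.fluxForm_proj

theorem smoothFun_fluxForm : SmoothFun Φ.fluxForm := by
  change ContDiff ℝ ∞ (fun y => Φ.fluxForm (proj y))
  rw [fluxForm_comp_proj]
  exact contDiff_parametric_intervalIntegral Φ.contDiff_fluxIntegrand 0 1

/-- Mixed partial derivatives of the lift commute. -/
theorem hasDerivAt_fderiv_lift (s : ℝ) (x : ℝ × ℝ) :
    HasDerivAt (fun r => fderiv ℝ (Φ.lift r) x) (fderiv ℝ (Φ.liftVelocity s) x) s := by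
  have h : (fun r => fderiv ℝ (Φ.lift r) x) = fun r => ContinuousLinearMap.id ℝ (ℝ × ℝ) +
      ∫ t in (0 : ℝ)..r, fderiv ℝ (Φ.liftVelocity t) x := by
    ext1 r
    exact ((hasFDerivAt_id x).add (hasFDerivAt_parametric_intervalIntegral
      (f := fun y t => Φ.liftVelocity t y)
      (Φ.contDiff_swap_liftVelocity.of_le (by simp)) 0 r x)).fderiv
  have hc : Continuous fun t => fderiv ℝ (Φ.liftVelocity t) x :=
    continuous_partial_fderiv (f := fun y t => Φ.liftVelocity t y) Φ.contDiff_swap_liftVelocity x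
  rw [h]
  exact (intervalIntegral.integral_hasDerivAt_right (hc.intervalIntegrable _ _)
    hc.aestronglyMeasurable.stronglyMeasurableAtFilter hc.continuousAt).const_add _

theorem omega_swap (u v : ℝ × ℝ) : omega u v = -omega v u := by
  simp only [omega_apply]
  ring

/-- Infinitesimal form of symplecticity: differentiate `omega_fderiv_lift` in `s` and use
antisymmetry. -/
theorem omega_fderiv_liftVelocity (s : ℝ) (x u v : ℝ × ℝ) :
    omega (fderiv ℝ (Φ.liftVelocity s) x u) (fderiv ℝ (Φ.lift s) x v) =
      omega (fderiv ℝ (Φ.liftVelocity s) x v) (fderiv ℝ (Φ.lift s) x u) := by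
  have h : ∀ w, HasDerivAt (fun r => fderiv ℝ (Φ.lift r) x w)
      (fderiv ℝ (Φ.liftVelocity s) x w) s := fun w => by
    simpa using (Φ.hasDerivAt_fderiv_lift s x).clm_apply (hasDerivAt_const s w)
  have h1 := (omega.hasFDerivAt.comp_hasDerivAt s (h u)).clm_apply (h v)
  have h2 : HasDerivAt
      (fun r => omega (fderiv ℝ (Φ.lift r) x u) (fderiv ℝ (Φ.lift r) x v)) 0 s := by
    simp only [omega_fderiv_lift]
    exact hasDerivAt_const _ _
  have h3 := h1.unique h2
  have h4 := omega_swap (fderiv ℝ (Φ.lift s) x u) (fderiv ℝ (Φ.liftVelocity s) x v)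
  simp only [Function.comp_apply] at h3
  linarith

/-- The product rule gives two terms: one is symmetric because second derivatives of the lift are,
the other by `omega_fderiv_liftVelocity`. Integrated over time, this is closedness of the flux form.
-/
theorem fderiv_fluxIntegrand_symm (x : ℝ × ℝ) (s : ℝ) (u v : ℝ × ℝ) :
    fderiv ℝ (fun y => Φ.fluxIntegrand y s) x u v =
      fderiv ℝ (fun y => Φ.fluxIntegrand y s) x v u := by
  have hW : DifferentiableAt ℝ (Φ.liftVelocity s) x :=
    (Φ.contDiff_liftVelocity.comp (contDiff_prodMk_right s)).differentiable (by simp) x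
  have hL : ContDiff ℝ ∞ (Φ.lift s) := Φ.contDiff_lift.comp (contDiff_prodMk_right s)
  have hD : DifferentiableAt ℝ (fderiv ℝ (Φ.lift s)) x :=
    (hL.fderiv_right (m := ∞) (by simp)).differentiable (by simp) x
  have h3 : ∀ u v, fderiv ℝ (fun y => Φ.fluxIntegrand y s) x u v =
      omega (Φ.liftVelocity s x) (fderiv ℝ (fderiv ℝ (Φ.lift s)) x u v) +
        omega (fderiv ℝ (Φ.liftVelocity s) x u) (fderiv ℝ (Φ.lift s) x v) := fun u v => by
    have h := ((omega.hasFDerivAt.comp x hW.hasFDerivAt).clm_comp hD.hasFDerivAt).fderiv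
    simp only [Function.comp_apply] at h
    simp only [fluxIntegrand, h]
    simp
  have h4 : IsSymmSndFDerivAt ℝ (Φ.lift s) x :=
    hL.contDiffAt.isSymmSndFDerivAt (by
      rw [minSmoothness_of_isRCLikeNormedField]
      exact WithTop.coe_le_coe.2 (le_top : (2 : ℕ∞) ≤ ⊤))
  rw [h3, h3, h4.eq u v, Φ.omega_fderiv_liftVelocity s x u v]

theorem formDeriv_fluxForm (x u v : ℝ × ℝ) : formDeriv Φ.fluxForm x u v =
    ∫ s in (0 : ℝ)..1, fderiv ℝ (fun y => Φ.fluxIntegrand y s) x u v := by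
  have hc := continuous_partial_fderiv Φ.contDiff_fluxIntegrand x
  have h1 : formDeriv Φ.fluxForm x =
      ∫ s in (0 : ℝ)..1, fderiv ℝ (fun y => Φ.fluxIntegrand y s) x := by
    rw [formDeriv, fluxForm_comp_proj]
    exact (hasFDerivAt_parametric_intervalIntegral
      (Φ.contDiff_fluxIntegrand.of_le (by simp)) 0 1 x).fderiv
  rw [h1, ContinuousLinearMap.intervalIntegral_apply (hc.intervalIntegrable _ _),
    ContinuousLinearMap.intervalIntegral_apply
      ((hc.clm_apply continuous_const).intervalIntegrable _ _)]

theorem fluxForm_mem_closedForms : Φ.fluxForm ∈ closedForms := by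
  refine ⟨Φ.smoothFun_fluxForm, fun x u v => sub_eq_zero.2 ?_⟩
  simp only [formDeriv_fluxForm, Φ.fderiv_fluxIntegrand_symm x _ u v]

end SymplecticIsotopy

/-! ### Green's formula for the area swept out by a square -/

/-- Up to sign, the one-form `ω(a, da)` has exterior derivative twice the integrand. Each pair of
opposite edges contributes `ω(k, e)` to the boundary integral, and the factor `2` cancels. -/
theorem integral_omega_eq_of_square {a : ℝ × ℝ → ℝ × ℝ} (ha : ContDiff ℝ ∞ a) {e k : ℝ × ℝ}
    (h0 : ∀ r, a (r, 0) = r • e) (h1 : ∀ r, a (r, 1) = r • e + k)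
    (hp : ∀ s, a (1, s) = a (0, s) + e) :
    ∫ r in (0 : ℝ)..1, ∫ s in (0 : ℝ)..1,
      omega (fderiv ℝ a (r, s) (0, 1)) (fderiv ℝ a (r, s) (1, 0)) = omega k e := by
  have hD : ContDiff ℝ ∞ (fderiv ℝ a) := ha.fderiv_right (by simp)
  have hda : ∀ z, HasFDerivAt a (fderiv ℝ a z) z := fun z =>
    (ha.differentiable (by simp) z).hasFDerivAt
  have hdD : ∀ z, HasFDerivAt (fderiv ℝ a) (fderiv ℝ (fderiv ℝ a) z) z := fun z =>
    (hD.differentiable (by simp) z).hasFDerivAt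
  have hQ : ∀ w : ℝ × ℝ, ContDiff ℝ ∞ (fun z => omega (a z) (fderiv ℝ a z w)) := fun w =>
    (omega.contDiff.comp ha).clm_apply (hD.clm_apply contDiff_const)
  have hQd : ∀ w z, HasFDerivAt (fun z => omega (a z) (fderiv ℝ a z w))
      (fderiv ℝ (fun z => omega (a z) (fderiv ℝ a z w)) z) z := fun w z =>
    ((hQ w).differentiable (by simp) z).hasFDerivAt
  have hQe : ∀ w z u, fderiv ℝ (fun z => omega (a z) (fderiv ℝ a z w)) z u =
      omega (fderiv ℝ a z u) (fderiv ℝ a z w) + omega (a z) (fderiv ℝ (fderiv ℝ a) z u w) :=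
    fun w z u => by
      have h := (omega.hasFDerivAt.comp z (hda z)).clm_apply
        ((hdD z).clm_apply (hasFDerivAt_const w z))
      have h' := h.fderiv
      simp only [Function.comp_def] at h'
      rw [h']
      simp
      ring
  have hdr : ∀ r s, HasDerivAt (fun r => a (r, s)) (fderiv ℝ a (r, s) (1, 0)) r := fun r s =>
    HasFDerivAt.comp_hasDerivAt (l := a) r (hda (r, s))
      ((hasDerivAt_id r).prodMk (hasDerivAt_const r s))
  have hds : ∀ r s, HasDerivAt (fun s => a (r, s)) (fderiv ℝ a (r, s) (0, 1)) s := fun r s =>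
    HasFDerivAt.comp_hasDerivAt (l := a) s (hda (r, s))
      ((hasDerivAt_const s r).prodMk (hasDerivAt_id s))
  -- In the divergence of this field the terms with second derivatives of `a` cancel by symmetry.
  have key := MeasureTheory.integral2_divergence_prod_of_hasFDerivAt
    (fun z => -omega (a z) (fderiv ℝ a z (0, 1))) (fun z => omega (a z) (fderiv ℝ a z (1, 0)))
    (fun z => -fderiv ℝ (fun z => omega (a z) (fderiv ℝ a z (0, 1))) z)
    (fun z => fderiv ℝ (fun z => omega (a z) (fderiv ℝ a z (1, 0))) z) 0 0 1 1
    (hQ _).continuous.neg.continuousOn (hQ _).continuous.continuousOn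
    (fun z _ => (hQd _ z).neg) (fun z _ => hQd _ z)
    (ContinuousOn.integrableOn_compact (isCompact_uIcc.prod isCompact_uIcc) (by
      have c1 := ((hQ (0, 1)).continuous_fderiv (by simp)).clm_apply
        (continuous_const (y := ((1 : ℝ), (0 : ℝ))))
      have c2 := ((hQ (1, 0)).continuous_fderiv (by simp)).clm_apply
        (continuous_const (y := ((0 : ℝ), (1 : ℝ))))
      exact (c1.neg.add c2).continuousOn))
  have hl : ∀ r s : ℝ, (-fderiv ℝ (fun z => omega (a z) (fderiv ℝ a z (0, 1))) (r, s)) (1, 0) +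
      fderiv ℝ (fun z => omega (a z) (fderiv ℝ a z (1, 0))) (r, s) (0, 1) =
      2 * omega (fderiv ℝ a (r, s) (0, 1)) (fderiv ℝ a (r, s) (1, 0)) := fun r s => by
    have hs : IsSymmSndFDerivAt ℝ a (r, s) := ha.contDiffAt.isSymmSndFDerivAt
      (by
        rw [minSmoothness_of_isRCLikeNormedField]
        exact WithTop.coe_le_coe.2 (le_top : (2 : ℕ∞) ≤ ⊤))
    rw [neg_apply, hQe, hQe, hs.eq (1, 0) (0, 1),
      SymplecticIsotopy.omega_swap (fderiv ℝ a (r, s) (1, 0))]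
    ring
  simp only [hl, intervalIntegral.integral_const_mul] at key
  have e0 : ∀ r, fderiv ℝ a (r, 0) (1, 0) = e := fun r => by
    have := hdr r 0
    simp only [h0] at this
    simpa using this.unique ((hasDerivAt_id r).smul_const e)
  have e1 : ∀ r, fderiv ℝ a (r, 1) (1, 0) = e := fun r => by
    have := hdr r 1
    simp only [h1] at this
    simpa using this.unique (((hasDerivAt_id r).smul_const e).add_const k)
  have ep : ∀ s, fderiv ℝ a (1, s) (0, 1) = fderiv ℝ a (0, s) (0, 1) := fun s => by
    have := hds 1 s
    simp only [hp] at this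
    exact this.unique ((hds 0 s).add_const e)
  have hcs : Continuous fun s : ℝ => fderiv ℝ a (0, s) (0, 1) :=
    (hD.continuous.comp (by fun_prop : Continuous fun s : ℝ => ((0 : ℝ), s))).clm_apply
      continuous_const
  have hk : ∫ s in (0 : ℝ)..1, fderiv ℝ a (0, s) (0, 1) = k := by
    rw [intervalIntegral.integral_eq_sub_of_hasDerivAt (fun s _ => hds 0 s)
      (hcs.intervalIntegrable _ _), h0, h1]
    simp
  have hf : (∫ s in (0 : ℝ)..1, -omega (a (1, s)) (fderiv ℝ a (1, s) (0, 1))) -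
      ∫ s in (0 : ℝ)..1, -omega (a (0, s)) (fderiv ℝ a (0, s) (0, 1)) = -omega e k := by
    have c : ∀ r : ℝ, Continuous fun s : ℝ => -omega (a (r, s)) (fderiv ℝ a (r, s) (0, 1)) :=
      fun r => ((hQ _).continuous.comp (by fun_prop : Continuous fun s : ℝ => (r, s))).neg
    rw [← intervalIntegral.integral_sub ((c 1).intervalIntegrable _ _)
      ((c 0).intervalIntegrable _ _), ← hk,
      ← ContinuousLinearMap.intervalIntegral_comp_comm _ (hcs.intervalIntegrable _ _),
      ← intervalIntegral.integral_neg]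
    refine intervalIntegral.integral_congr fun s _ => ?_
    simp only [ep, hp, map_add, add_apply]
    ring
  have hg : (∫ r in (0 : ℝ)..1, omega (a (r, 1)) (fderiv ℝ a (r, 1) (1, 0))) -
      ∫ r in (0 : ℝ)..1, omega (a (r, 0)) (fderiv ℝ a (r, 0) (1, 0)) = omega k e := by
    have c : ∀ s : ℝ, Continuous fun r : ℝ => omega (a (r, s)) (fderiv ℝ a (r, s) (1, 0)) :=
      fun s => (hQ _).continuous.comp (by fun_prop : Continuous fun r : ℝ => (r, s))
    rw [← intervalIntegral.integral_sub ((c 1).intervalIntegrable _ _)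
      ((c 0).intervalIntegrable _ _)]
    simp [e0, e1, h0, h1]
  have := SymplecticIsotopy.omega_swap e k
  linarith

/-! ### Cohomology classes of constant forms -/

/-- The one-form with constant coefficients `L`. -/
def constForm (L : ℝ × ℝ →L[ℝ] ℝ) : OneForm := fun _ => L

theorem constForm_mem (L : ℝ × ℝ →L[ℝ] ℝ) : constForm L ∈ closedForms :=
  ⟨contDiff_const, fun x u v => by simp [formDeriv, constForm]⟩

theorem deRhamClass_eq_iff {α β : OneForm} (hα : α ∈ closedForms) (hβ : β ∈ closedForms) :
    deRhamClass α hα = deRhamClass β hβ ↔ α - β ∈ exactForms :=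
  Submodule.Quotient.eq _

theorem ext_lattice {L M : ℝ × ℝ →L[ℝ] ℝ} (h : ∀ k, L (lattice k) = M (lattice k)) : L = M := by
  have h1 := h (1, 0)
  have h2 := h (0, 1)
  simp only [lattice, Int.cast_one, Int.cast_zero] at h1 h2
  ext <;> simpa

/-- A closed form is cohomologous to the constant form with the same periods. -/
theorem sub_constForm_mem_exactForms {α : OneForm} (hα : SmoothFun α) {f : ℝ × ℝ → ℝ}
    (hf : ∀ x, HasFDerivAt f (α (proj x)) x) {L : ℝ × ℝ →L[ℝ] ℝ}
    (hL : ∀ k, f (lattice k) - f 0 = L (lattice k)) : α - constForm L ∈ exactForms := by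
  set h : ℝ × ℝ → ℝ := fun x => f x - L x with hh
  have hd : ∀ x, HasFDerivAt h (α (proj x) - L) x := fun x => (hf x).sub L.hasFDerivAt
  have hs : ContDiff ℝ ∞ h := by
    refine contDiff_infty_iff_fderiv.2 ⟨fun x => (hd x).differentiableAt, ?_⟩
    rw [show fderiv ℝ h = fun x => α (proj x) - L from funext fun x => (hd x).fderiv]
    exact ContDiff.sub hα contDiff_const
  -- The differential of `h` is periodic, so `h (y + lattice k) - h y` is constant in `y`; `hL` says
  -- that it vanishes at `0`.
  have hper : ∀ x k, h (x + lattice k) = h x := fun x k => by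
    have h1 : ∀ y, HasFDerivAt (fun y => h (y + lattice k) - h y) (0 : ℝ × ℝ →L[ℝ] ℝ) y :=
      fun y => by
        have h2 := ((hd (y + lattice k)).comp y
          ((hasFDerivAt_id y).add_const (lattice k))).sub (hd y)
        rw [ContinuousLinearMap.comp_id] at h2
        rw [proj_add_lattice, sub_self] at h2
        exact h2
    have h3 := is_const_of_fderiv_eq_zero (𝕜 := ℝ) (fun y => (h1 y).differentiableAt)
      (fun y => (h1 y).fderiv) x 0
    have h4 := hL k
    simp only [zero_add, hh, map_zero, sub_zero] at h3
    simp only [hh]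
    linarith
  have hdesc : ∀ x, h (coords (proj x)) = h x := fun x => by
    obtain ⟨k, hk⟩ := (proj_eq_zero_iff (x := coords (proj x) - x)).1
      (by rw [proj_sub, proj_coords, sub_self])
    rw [← hper x k, hk, add_sub_cancel]
  have hdesc' : (fun x => h (coords (proj x))) = h := funext hdesc
  refine ⟨fun q => h (coords q), ?_, fun x => ?_⟩
  · change ContDiff ℝ ∞ (fun x => h (coords (proj x)))
    rwa [hdesc']
  · change α (proj x) - L = fderiv ℝ (fun x => h (coords (proj x))) x
    rw [hdesc', (hd x).fderiv]

/-- A periodic primitive differs from `L` by a constant, so `L` vanishes on the lattice, which spans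
the plane. -/
theorem eq_zero_of_constForm_mem_exactForms {L : ℝ × ℝ →L[ℝ] ℝ} (h : constForm L ∈ exactForms) :
    L = 0 := by
  obtain ⟨f, hf, hfL⟩ := h
  have hd : ∀ x, HasFDerivAt (fun y => f (proj y) - L y) (0 : ℝ × ℝ →L[ℝ] ℝ) x := fun x => by
    have h1 : HasFDerivAt (fun y => f (proj y)) L x := by
      rw [show L = _ from hfL x]
      exact (ContDiff.differentiable hf (by simp) x).hasFDerivAt
    have h2 := h1.sub L.hasFDerivAt
    rw [sub_self] at h2
    exact h2
  refine ext_lattice fun k => ?_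
  have h := is_const_of_fderiv_eq_zero (𝕜 := ℝ) (fun y => (hd y).differentiableAt)
    (fun y => (hd y).fderiv) (lattice k) 0
  simp only [proj_lattice, proj_zero, map_zero] at h
  simpa using h

theorem deRhamClass_constForm_injective {L M : ℝ × ℝ →L[ℝ] ℝ}
    (h : deRhamClass (constForm L) (constForm_mem L) =
      deRhamClass (constForm M) (constForm_mem M)) : L = M :=
  sub_eq_zero.1 (eq_zero_of_constForm_mem_exactForms ((deRhamClass_eq_iff _ _).1 h))

/-- Integral classes are represented by the contractions of integral constant fields. -/
theorem integralClass_apply (k : ℤ × ℤ) : integralClass k =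
    deRhamClass (constForm (omega (lattice (k.2, -k.1)))) (constForm_mem _) := by
  change k.1 • deRhamClass dx dx_mem + k.2 • deRhamClass dy dy_mem = _
  rw [← Int.cast_smul_eq_zsmul ℝ, ← Int.cast_smul_eq_zsmul ℝ]
  refine congrArg (Submodule.Quotient.mk (p := exactForms.submoduleOf closedForms))
    (Subtype.ext (funext fun q => ContinuousLinearMap.ext fun v => ?_))
  change (k.1 : ℝ) * v.1 + (k.2 : ℝ) * v.2 = omega (lattice (k.2, -k.1)) v
  simp only [omega_apply, lattice]
  push_cast
  ring

theorem omega_injective {u v : ℝ × ℝ} (h : omega u = omega v) : u = v := by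
  have h1 := congrArg (fun L : ℝ × ℝ →L[ℝ] ℝ => L (0, 1)) h
  have h2 := congrArg (fun L : ℝ × ℝ →L[ℝ] ℝ => L (1, 0)) h
  simp only [omega_apply, mul_one, mul_zero, sub_zero, zero_sub, neg_inj] at h1 h2
  exact Prod.ext h1 h2

theorem lattice_injective : Function.Injective lattice := fun k l h => by
  simpa [lattice, Prod.ext_iff] using h

theorem integralClass_injective : Function.Injective integralClass := fun k l h => by
  rw [integralClass_apply, integralClass_apply] at h
  have h1 := lattice_injective (omega_injective (deRhamClass_constForm_injective h))
  simp only [Prod.mk.injEq, neg_inj] at h1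
  exact Prod.ext h1.2 h1.1

/-! ### The flux of a loop -/

namespace SymplecticIsotopy

theorem flux_eq (Φ : SymplecticIsotopy) :
    Φ.flux = deRhamClass Φ.fluxForm Φ.fluxForm_mem_closedForms :=
  dif_pos _

/-- The period of the flux form along a lattice vector, in terms of the displacement `k` of the
lift of the loop. -/
theorem integral_fluxForm_lattice {Φ : SymplecticIsotopy} {k : ℤ × ℤ}
    (hk : ∀ x, Φ.lift 1 x = x + lattice k) (l : ℤ × ℤ) :
    ∫ r in (0 : ℝ)..1, Φ.fluxForm (proj (r • lattice l)) (lattice l) =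
      omega (lattice k) (lattice l) := by
  have hm : ContDiff ℝ ∞ (fun z : ℝ × ℝ => (z.2, z.1 • lattice l)) :=
    contDiff_snd.prodMk (contDiff_fst.smul contDiff_const)
  have ha : ContDiff ℝ ∞ (fun z : ℝ × ℝ => Φ.lift z.2 (z.1 • lattice l)) :=
    Φ.contDiff_lift.comp hm
  -- The square swept out by the segment from `0` to `l`: its top edge is the bottom one shifted by
  -- `k`, its right edge the left one shifted by `l`.
  set a : ℝ × ℝ → ℝ × ℝ := fun z => Φ.lift z.2 (z.1 • lattice l) with hadef
  have hda : ∀ z, HasFDerivAt a (fderiv ℝ a z) z := fun z =>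
    (ha.differentiable (by simp) z).hasFDerivAt
  have hs : ∀ r s : ℝ, fderiv ℝ a (r, s) (0, 1) = Φ.liftVelocity s (r • lattice l) :=
    fun r s => HasDerivAt.unique (HasFDerivAt.comp_hasDerivAt (l := a) s (hda (r, s))
      ((hasDerivAt_const s r).prodMk (hasDerivAt_id s))) (Φ.hasDerivAt_lift s (r • lattice l))
  have hr : ∀ r s : ℝ, fderiv ℝ a (r, s) (1, 0) =
      fderiv ℝ (Φ.lift s) (r • lattice l) (lattice l) := fun r s => by
    have h1 : HasDerivAt (fun r => a (r, s)) (fderiv ℝ a (r, s) (1, 0)) r :=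
      HasFDerivAt.comp_hasDerivAt (l := a) r (hda (r, s))
        ((hasDerivAt_id r).prodMk (hasDerivAt_const r s))
    have h2 : HasDerivAt (fun r => a (r, s))
        (fderiv ℝ (Φ.lift s) (r • lattice l) ((1 : ℝ) • lattice l)) r :=
      HasFDerivAt.comp_hasDerivAt (l := Φ.lift s) r
        (Φ.differentiableAt_lift s (r • lattice l)).hasFDerivAt
        ((hasDerivAt_id r).smul_const (lattice l))
    rw [h1.unique h2, one_smul]
  rw [← integral_omega_eq_of_square ha (e := lattice l) (k := lattice k)
    (fun r => Φ.lift_zero _) (fun r => hk _) (fun s => by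
      have := Φ.lift_add_lattice s 0 l
      simpa [hadef] using this)]
  refine intervalIntegral.integral_congr fun r _ => ?_
  have hc : Continuous fun s => Φ.fluxIntegrand (r • lattice l) s :=
    Continuous.uncurry_left (f := Φ.fluxIntegrand) (r • lattice l)
      Φ.contDiff_fluxIntegrand.continuous
  simp only [hs, hr]
  rw [show Φ.fluxForm (proj (r • lattice l)) = _ from congrFun Φ.fluxForm_comp_proj (r • lattice l),
    ContinuousLinearMap.intervalIntegral_apply (hc.intervalIntegrable _ _)]
  rfl

/-- The Poincaré lemma gives a primitive on the plane; its increments along lattice vectors are the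
periods `ω(k, l)`, which are also those of the constant form. -/
theorem IsLoop.exists_flux_eq {Φ : SymplecticIsotopy} (hΦ : Φ.IsLoop) :
    ∃ k, Φ.flux = deRhamClass (constForm (omega (lattice k))) (constForm_mem _) := by
  obtain ⟨k, hk⟩ := hΦ.exists_lift_one
  refine ⟨k, ?_⟩
  rw [flux_eq, deRhamClass_eq_iff]
  have hs : ContDiff ℝ ∞ (fun y => Φ.fluxForm (proj y)) := Φ.smoothFun_fluxForm
  obtain ⟨f, hf⟩ := convex_univ.exists_forall_hasFDerivAt_of_fderiv_symmetric isOpen_univ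
    (hs.differentiable (by simp)).differentiableOn
    (fun x _ u v => sub_eq_zero.1 (Φ.fluxForm_mem_closedForms.2 x u v))
  refine sub_constForm_mem_exactForms Φ.smoothFun_fluxForm (fun x => hf x (Set.mem_univ x))
    fun l => ?_
  rw [← integral_fluxForm_lattice hk l, intervalIntegral.integral_eq_sub_of_hasDerivAt
    (f := fun r : ℝ => f (r • lattice l))]
  · simp
  · intro r _
    have h := HasFDerivAt.comp_hasDerivAt (l := f) r (hf (r • lattice l) (Set.mem_univ _))
      ((hasDerivAt_id r).smul_const (lattice l))
    rw [one_smul] at h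
    exact h
  · have : Continuous fun r : ℝ => r • lattice l := continuous_id.smul continuous_const
    exact ((hs.continuous.comp this).clm_apply continuous_const).intervalIntegrable _ _

/-- The loop of translations in the direction of a lattice vector. -/
def translation (k : ℤ × ℤ) : SymplecticIsotopy where
  map t := Equiv.addRight (proj (t • lattice k))
  smooth _ _ := ⟨Set.univ, isOpen_univ, Set.mem_univ _, fun z => z.2 + z.1 • lattice k,
    (contDiff_snd.add (contDiff_fst.smul contDiff_const)).contDiffOn, fun _ _ => rfl⟩
  smooth_symm t _ _ _ := ⟨Set.univ, isOpen_univ, Set.mem_univ _, fun x => x - t • lattice k,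
    (contDiff_id.sub contDiff_const).contDiffOn, fun x _ => by
      rw [proj_sub, sub_eq_add_neg]
      rfl⟩
  symplectic t _ p u v := by
    obtain ⟨x, rfl⟩ := proj_surjective p
    rw [tangentMap_proj (g := fun x => x + t • lattice k) (by fun_prop)
      (Filter.Eventually.of_forall fun y => rfl)]
    simp
  map_zero := by
    ext1 p
    simp [proj_zero]

theorem tangentMap_translation (k : ℤ × ℤ) (t : ℝ) (x : ℝ × ℝ) :
    tangentMap ((translation k).map t) (proj x) = ContinuousLinearMap.id ℝ (ℝ × ℝ) := by
  rw [tangentMap_proj (g := fun x => x + t • lattice k) (by fun_prop)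
    (Filter.Eventually.of_forall fun y => rfl)]
  simp

theorem velocity_translation (k : ℤ × ℤ) {t : ℝ} (ht : t ∈ Set.Icc (0 : ℝ) 1) (x : ℝ × ℝ) :
    (translation k).velocity t (proj x) = lattice k := by
  have h : HasDerivAt (fun s : ℝ => x + s • lattice k) (lattice k) t := by
    simpa using ((hasDerivAt_id t).smul_const (lattice k)).const_add x
  exact (hasDerivWithinAt_coords h.hasDerivWithinAt (Filter.Eventually.of_forall fun s => rfl)
    rfl).derivWithin (uniqueDiffOn_Icc zero_lt_one t ht)

theorem isLoop_translation (k : ℤ × ℤ) : (translation k).IsLoop := by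
  ext1 p
  simp [translation, proj_lattice]

theorem fluxForm_translation (k : ℤ × ℤ) :
    (translation k).fluxForm = constForm (omega (lattice k)) := by
  funext p
  obtain ⟨x, rfl⟩ := proj_surjective p
  have h : ∀ t ∈ Set.uIcc (0 : ℝ) 1, pullback ((translation k).map t)
      (contract ((translation k).generator t)) (proj x) = omega (lattice k) := fun t ht => by
    rw [Set.uIcc_of_le zero_le_one] at ht
    simp [pullback, contract, generator, tangentMap_translation, velocity_translation k ht]
  rw [fluxForm, intervalIntegral.integral_congr h]
  simp [constForm]

theorem flux_translation (k : ℤ × ℤ) : (translation k).flux =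
    deRhamClass (constForm (omega (lattice k))) (constForm_mem _) := by
  rw [flux_eq]
  simp only [fluxForm_translation]

end SymplecticIsotopy

/-- The quarter turn `(k.2, -k.1)` appears because `ι_{∂x} ω = dy` and `ι_{∂y} ω = -dx`. -/
theorem range_integralClass : Set.range integralClass = fluxGroup := by
  ext c
  constructor
  · rintro ⟨k, rfl⟩
    exact ⟨.translation (k.2, -k.1), SymplecticIsotopy.isLoop_translation _, by
      rw [SymplecticIsotopy.flux_translation, integralClass_apply]⟩
  · rintro ⟨Φ, hΦ, rfl⟩
    obtain ⟨k, hk⟩ := hΦ.exists_flux_eq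
    exact ⟨(-k.2, k.1), by rw [hk, integralClass_apply, neg_neg]⟩

/-! ### Harmonic forms -/

theorem isHarmonic_constForm (L : ℝ × ℝ →L[ℝ] ℝ) : IsHarmonic (constForm L) :=
  ⟨constForm_mem L, fun x => by simp [codifferential, formDeriv, constForm]⟩

/-- Used to bound a smooth form on the whole plane by its maximum on a compact set. -/
theorem range_comp_proj_subset (α : OneForm) :
    Set.range (fun x => α (proj x)) ⊆
      (fun x => α (proj x)) '' Metric.closedBall (0 : ℝ × ℝ) 1 := by
  rintro _ ⟨x, rfl⟩
  refine ⟨coords (proj x), ?_, by simp only [proj_coords]⟩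
  have h : ∀ q : UnitAddCircle,
      ‖((AddCircle.equivIoc (1 : ℝ) (-1 / 2) q : Set.Ioc _ _) : ℝ)‖ ≤ 1 := fun q => by
    have := (AddCircle.equivIoc (1 : ℝ) (-1 / 2) q).2
    exact abs_le.2 ⟨by linarith [this.1], by linarith [this.2]⟩
  rw [mem_closedBall_zero_iff]
  exact max_le (h (proj x).1) (h (proj x).2)

/-- Harmonic one-forms have constant coefficients. -/
theorem IsHarmonic.eq_constForm {α : OneForm} (hα : IsHarmonic α) : ∃ L, α = constForm L := by
  have hs : ContDiff ℝ ∞ (fun x => α (proj x)) := hα.1.1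
  have hd : ∀ x, HasFDerivAt (fun x => α (proj x)) (formDeriv α x) x := fun x =>
    (hs.differentiable (by simp) x).hasFDerivAt
  obtain ⟨C, hC⟩ := ((isCompact_closedBall (0 : ℝ × ℝ) 1).exists_bound_of_continuousOn
    hs.continuous.continuousOn)
  have hb : ∀ x, ‖α (proj x)‖ ≤ C := fun x => by
    obtain ⟨y, hy, hxy⟩ := range_comp_proj_subset α ⟨x, rfl⟩
    simp only at hxy
    exact hxy ▸ hC y hy
  -- For `α = a dx + b dy` this is `a - i b`; closedness and co-closedness are its Cauchy–Riemann
  -- equations.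
  set f : ℂ → ℂ := fun z => (α (proj (z.re, z.im)) (1, 0) : ℂ) -
    Complex.I * (α (proj (z.re, z.im)) (0, 1) : ℂ) with hf
  have hfd : Differentiable ℂ f := by
    intro z
    have h1 : HasFDerivAt (fun z : ℂ => α (proj (z.re, z.im)))
        ((formDeriv α (z.re, z.im)).comp (Complex.reCLM.prod Complex.imCLM)) z :=
      HasFDerivAt.comp (g := fun x => α (proj x)) z (hd (z.re, z.im))
        (Complex.reCLM.prod Complex.imCLM).hasFDerivAt
    have h3 := (Complex.ofRealCLM.hasFDerivAt.comp z
      (h1.clm_apply (hasFDerivAt_const ((1 : ℝ), (0 : ℝ)) z))).sub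
      ((Complex.ofRealCLM.hasFDerivAt.comp z
        (h1.clm_apply (hasFDerivAt_const ((0 : ℝ), (1 : ℝ)) z))).const_mul Complex.I)
    refine differentiableAt_complex_iff_differentiableAt_real.2 ⟨h3.differentiableAt, ?_⟩
    rw [show fderiv ℝ f z = _ from h3.fderiv]
    have hcl := hα.1.2 (z.re, z.im) (1, 0) (0, 1)
    have hco := hα.2 (z.re, z.im)
    rw [codifferential] at hco
    apply Complex.ext
    · simp
      linarith
    · simp
      linarith
  have hbdd : Bornology.IsBounded (Set.range f) := by
    refine isBounded_iff_forall_norm_le.2 ⟨C * ‖((1 : ℝ), (0 : ℝ))‖ + C * ‖((0 : ℝ), (1 : ℝ))‖, ?_⟩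
    rintro _ ⟨z, rfl⟩
    refine (norm_sub_le _ _).trans (add_le_add ?_ ?_)
    · rw [Complex.norm_real]
      exact ContinuousLinearMap.le_of_opNorm_le _ (hb _) _
    · rw [norm_mul, Complex.norm_I, one_mul, Complex.norm_real]
      exact ContinuousLinearMap.le_of_opNorm_le _ (hb _) _
  refine ⟨α 0, funext fun p => ?_⟩
  obtain ⟨x, rfl⟩ := proj_surjective p
  -- Liouville's theorem.
  have h := hfd.apply_eq_apply_of_bounded hbdd ⟨x.1, x.2⟩ 0
  have h1 := congrArg Complex.re h
  have h2 := congrArg Complex.im h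
  simp [hf] at h1 h2
  change _ = α (proj 0) _ at h1
  change _ = α (proj 0) _ at h2
  change α (proj x) = α (proj 0)
  refine ContinuousLinearMap.prod_ext ?_ ?_
  · ext
    simpa using h1
  · ext
    simpa using h2

theorem isHarmonicRep_iff {L : ℝ × ℝ →L[ℝ] ℝ} {α : OneForm} :
    IsHarmonicRep α (deRhamClass (constForm L) (constForm_mem L)) ↔ α = constForm L := by
  constructor
  · rintro ⟨hα, h, hc⟩
    obtain ⟨M, rfl⟩ := hα.eq_constForm
    rw [deRhamClass_constForm_injective hc]
  · rintro rfl
    exact ⟨isHarmonic_constForm L, constForm_mem L, rfl⟩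

theorem contract_eq_iff {A : VField} {v : ℝ × ℝ} :
    contract A = constForm (omega v) ↔ A = fun _ => v := by
  constructor
  · exact fun h => funext fun p => omega_injective (congrFun h p)
  · rintro rfl
    rfl

/-! ### Flows of constant vector fields -/

/-- Uniqueness is `eq_proj_of_hasDerivWithinAt` applied to each orbit and the straight line `x + s •
v`. -/
theorem isFlow_const_iff {v : ℝ × ℝ} {ψ : ℝ → Torus → Torus} :
    IsFlow (fun _ => v) ψ ↔ ψ = fun t p => p + proj (t • v) := by
  have hg : ∀ (x : ℝ × ℝ) (t : ℝ), HasDerivAt (fun s : ℝ => x + s • v) v t := fun x t => by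
    simpa using ((hasDerivAt_id t).smul_const v).const_add x
  constructor
  · rintro ⟨h0, h⟩
    funext t p
    obtain ⟨x, rfl⟩ := proj_surjective p
    exact eq_proj_of_hasDerivWithinAt (c := fun t => ψ t (proj x)) (g := fun s => x + s • v)
      (v := fun _ => v) (s := Set.univ) (a := 0) convex_univ
      (fun t _ => (h t (proj x)).hasDerivWithinAt) (fun t _ => (hg x t).hasDerivWithinAt)
      (Set.mem_univ _) (by simp [h0]) (Set.mem_univ t)
  · rintro rfl
    refine ⟨fun p => by simp [proj_zero], fun t p => ?_⟩
    obtain ⟨x, rfl⟩ := proj_surjective p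
    exact hasDerivWithinAt_univ.1 (hasDerivWithinAt_coords (c := fun s => proj x + proj (s • v))
      (hg x t).hasDerivWithinAt (Filter.Eventually.of_forall fun s => rfl) rfl)

end TorusFlux

end

theorem mainTheorem10 (Φ : TorusFlux.SymplecticIsotopy) (hΦ : Φ.IsLoop) :
    -- the flux group is the lattice of integral classes, a copy of `ℤ²`
    (Function.Injective TorusFlux.integralClass ∧
      Set.range TorusFlux.integralClass = TorusFlux.fluxGroup) ∧
    -- the flux form is closed, so that the flux of `Φ` is its cohomology class
    Φ.fluxForm ∈ TorusFlux.closedForms ∧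
    -- the flux has exactly one harmonic representative
    (∃! α : TorusFlux.OneForm, TorusFlux.IsHarmonicRep α Φ.flux) ∧
    ∀ α : TorusFlux.OneForm, TorusFlux.IsHarmonicRep α Φ.flux →
      -- which is the contraction of exactly one harmonic vector field
      (∃! A : TorusFlux.VField, TorusFlux.IsHarmonicField A ∧ TorusFlux.contract A = α) ∧
      ∀ A : TorusFlux.VField, TorusFlux.IsHarmonicField A → TorusFlux.contract A = α →
        -- this field is constant, and it has exactly one flow
        (∃ v : ℝ × ℝ, ∀ p, A p = v) ∧
        (∃! ψ : ℝ → TorusFlux.Torus → TorusFlux.Torus, TorusFlux.IsFlow A ψ) ∧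
        ∀ ψ : ℝ → TorusFlux.Torus → TorusFlux.Torus, TorusFlux.IsFlow A ψ →
          (ψ 1 = id ↔ Φ.flux ∈ TorusFlux.fluxGroup) := by
  obtain ⟨k, hk⟩ := hΦ.exists_flux_eq
  rw [hk]
  simp only [TorusFlux.isHarmonicRep_iff]
  refine ⟨⟨TorusFlux.integralClass_injective, TorusFlux.range_integralClass⟩,
    Φ.fluxForm_mem_closedForms, existsUnique_eq, ?_⟩
  rintro α rfl
  constructor
  · refine ⟨fun _ => TorusFlux.lattice k,
      ⟨TorusFlux.isHarmonic_constForm _, TorusFlux.contract_eq_iff.2 rfl⟩, fun A hA => ?_⟩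
    exact TorusFlux.contract_eq_iff.1 hA.2
  · intro A _ hA
    obtain rfl := TorusFlux.contract_eq_iff.1 hA
    simp only [TorusFlux.isFlow_const_iff]
    refine ⟨⟨_, fun _ => rfl⟩, existsUnique_eq, ?_⟩
    rintro ψ rfl
    -- Both sides hold outright: the time-one map is translation by a lattice vector, and `Φ` itself
    -- witnesses membership in the flux group.
    refine iff_of_true (funext fun p => ?_) ⟨Φ, hΦ, hk⟩
    simp [TorusFlux.proj_lattice]
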